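/- Let $K$ be a field and let $\Delta$ be a simplicial complex on $[n]=\{1,\dots,n\}$, i.e. a family of subsets of $[n]$ (faces) closed under taking subsets, with vertex set $V(\Delta)=\{i:\{i\}\in\Delta\}$. Write $\dim\Delta=d-1$, where $d$ is the maximal cardinality of a face, and assume $\dim\Delta>1$. Call $C\subseteq[n]$ a clique of $\Delta$ if every $d$-element subset of $C$ is a facet (an inclusion-maximal face) of $\Delta$; by a maximal clique we mean an inclusion-maximal clique with at least $d$ elements (sets with fewer than $d$ elements are cliques only vacuously). Assume that $\Delta$ is a unit-interval simplicial complex, i.e. all facets of $\Delta$ have the same dimension, and for every facet $F=\{i_1<\dots<i_d\}$ the interval $[i_1,i_d]=\{i_1,i_1+1,\dots,i_d\}$ is a clique. Let $B_1,\dots,B_m$ be the maximal cliques of $\Delta$ and suppose that they form a partition of $V(\Delta)$. Let $\Gamma=\mathrm{Ind}(\Delta)$ be the simplicial complex of all subsets of $[n]$ that contain no facet of $\Delta$. For $F\subseteq[n]$ put $\mathbf{x}_F=\prod_{i\in F}x_i$ (so $\mathbf{x}_\emptyset=1$), and let $R_\Gamma=K[\mathbf{x}_Ft : F\in\Gamma]\subseteq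 K[x_1,\dots,x_n,t]$. For $i\in[n]$ and $j\in\{1,\dots,m\}$ define the ideals of $R_\Gamma$ $$P_i=(\mathbf{x}_Ft : F\in\Gamma,\ i\notin F),\qquad L_j=(\mathbf{x}_Ft : F\in\Gamma,\ f_j(p_F)>0),$$ where $f_j(x)=-\sum_{k\in B_j}x_k+(d-1)x_{n+1}$ and $p_F=\sum_{i\in F}e_i+e_{n+1}\in\mathbb{Z}^{n+1}$, with $e_1,\dots,e_{n+1}$ the canonical basis of $\mathbb{Z}^{n+1}$. Then the set of height one prime ideals of $R_\Gamma$ that are generated by monomials and contain $t$ is exactly $$\{P_i : i=1,\dots,n\}\cup\{L_j : j=1,\dots,m\}.$$ -/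

import Mathlib

noncomputable section

/-- A simplicial complex on `[n] = Fin n`: a family of subsets of `[n]` (the faces) closed under
taking subsets. The empty face is kept as a face, since it contributes the monomial `t` to the
toric ring below (Mathlib's `AbstractSimplicialComplex` drops it). -/
abbrev FinComplex (n : ℕ) := LowerSet (Finset (Fin n))

namespace FinComplex

variable {n : ℕ}

/-- The maximal cardinality `d` of a face, that is, `dim Δ + 1`. -/
def rank (Δ : FinComplex n) : ℕ := sSup (Finset.card '' (Δ : Set (Finset (Fin n))))

/-- The dimension of `Δ`: the maximum of `|F| - 1` over the faces `F`. -/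
def dim (Δ : FinComplex n) : ℤ := (rank Δ : ℤ) - 1

/-- The facets: the faces maximal under inclusion. -/
def IsFacet (Δ : FinComplex n) (F : Finset (Fin n)) : Prop := Maximal (fun G => G ∈ Δ) F

/-- The set `V(Δ)` of those `i` such that `{i}` is a face. -/
def vertices (Δ : FinComplex n) : Finset (Fin n) := by
  classical exact Finset.univ.filter fun i => ({i} : Finset (Fin n)) ∈ Δ

/-- All facets have the same dimension. -/
def IsPure (Δ : FinComplex n) : Prop := ∀ F G, IsFacet Δ F → IsFacet Δ G → F.card = G.card

/-- With `d = dim Δ + 1`: all `d`-subsets of `C` are facets. -/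
def IsClique (Δ : FinComplex n) (C : Finset (Fin n)) : Prop :=
  ∀ S ⊆ C, S.card = rank Δ → IsFacet Δ S

/-- The cliques maximal under inclusion. Sets with fewer than `d = dim Δ + 1` elements satisfy
`IsClique` vacuously; they are not counted here, so a maximal clique contains a facet. -/
def maximalCliques (Δ : FinComplex n) : Set (Finset (Fin n)) :=
  {B | Maximal (IsClique Δ) B ∧ rank Δ ≤ B.card}

/-- `Δ` is pure, and for each facet `F = {i₁ < ⋯ < i_d}` the interval `[i₁, i_d]` is a clique. -/
def IsUnitInterval (Δ : FinComplex n) : Prop :=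
  IsPure Δ ∧ ∀ F, IsFacet Δ F → ∀ h : F.Nonempty,
    IsClique Δ (Finset.Icc (F.min' h) (F.max' h))

/-- The independence complex `Ind(Δ)`: all subsets of `[n]` containing no facet of `Δ`. -/
def ind (Δ : FinComplex n) : FinComplex n where
  carrier := {D | ∀ F, IsFacet Δ F → ¬ F ⊆ D}
  lower' := fun _ _ hED hD F hF hFE => hD F hF (hFE.trans hED)

/-- The monomial `x_F t` in `K[x₁, …, xₙ, t]`, where `X (some i)` is `xᵢ` and `X none` is `t`. -/
def faceMonomial (K : Type*) [Field K] (F : Finset (Fin n)) : MvPolynomial (Option (Fin n)) K :=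
  (∏ i ∈ F, MvPolynomial.X (some i)) * MvPolynomial.X none

/-- The toric ring `R_Γ = K[x_F t : F ∈ Γ]`. -/
def toricRing (K : Type*) [Field K] (Γ : FinComplex n) :
    Subalgebra K (MvPolynomial (Option (Fin n)) K) :=
  Algebra.adjoin K {f | ∃ F ∈ Γ, f = faceMonomial K F}

/-- The ideal is generated by monomials `x₁^{a₁} ⋯ xₙ^{aₙ} t^k` belonging to the toric ring. -/
def IsMonomialIdeal {K : Type*} [Field K] {Γ : FinComplex n} (I : Ideal (toricRing K Γ)) : Prop :=
  ∃ S : Set (toricRing K Γ),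
    (∀ r ∈ S, ∃ a : Option (Fin n) →₀ ℕ,
      (r : MvPolynomial (Option (Fin n)) K) = MvPolynomial.monomial a 1) ∧
    I = Ideal.span S

/-- The set of height one monomial prime ideals of `R_Γ` containing `t`. -/
def heightOneMonomialPrimes (K : Type*) [Field K] (Γ : FinComplex n) :
    Set (Ideal (toricRing K Γ)) :=
  {P | P.IsPrime ∧ IsMonomialIdeal P ∧ P.height = 1 ∧
    ∃ r ∈ P, (r : MvPolynomial (Option (Fin n)) K) = MvPolynomial.X none}

/-- The ideal `P_C = (x_F t : F ∈ Γ, F ⊆ C)` of `R_Γ`. -/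
def coverIdeal (K : Type*) [Field K] (Γ : FinComplex n) (C : Finset (Fin n)) :
    Ideal (toricRing K Γ) :=
  Ideal.span {r | ∃ F ∈ Γ, F ⊆ C ∧
    (r : MvPolynomial (Option (Fin n)) K) = faceMonomial K F}

/-- The ideal `P_i = P_C` for `C = [n] \ {i}`. -/
def vertexIdeal (K : Type*) [Field K] (Γ : FinComplex n) (i : Fin n) : Ideal (toricRing K Γ) :=
  coverIdeal K Γ (Finset.univ.erase i)

/-- The lattice point `p_F = ∑_{i ∈ F} e_i + e_{n+1}`, the last coordinate having index `none`. -/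
def facePoint (F : Finset (Fin n)) : Option (Fin n) → ℤ :=
  ∑ i ∈ F, Pi.single (some i) 1 + Pi.single none 1

/-- The linear form `f_B(x) = -∑_{k ∈ B} x_k + (d - 1) x_{n+1}`, where `d - 1 = dim Δ`. -/
def cliqueForm (Δ : FinComplex n) (B : Finset (Fin n)) (x : Option (Fin n) → ℤ) : ℤ :=
  -(∑ k ∈ B, x (some k)) + dim Δ * x none

/-- The ideal `L_B = (x_F t : F ∈ Γ, f_B(p_F) > 0)` of `R_Γ`, where `Γ = Ind(Δ)`. -/
def cliqueIdeal (K : Type*) [Field K] (Δ : FinComplex n) (B : Finset (Fin n)) :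
    Ideal (toricRing K (ind Δ)) :=
  Ideal.span {r | ∃ F ∈ ind Δ, 0 < cliqueForm Δ B (facePoint F) ∧
    (r : MvPolynomial (Option (Fin n)) K) = faceMonomial K F}

end FinComplex

end

/-!
The maximal cliques `B` are disjoint and every facet of `Δ` is a `d`-subset of one of them, so
`Γ = Ind(Δ)` consists of the sets `F` with `|F ∩ B| ≤ d - 1` for all `B`
(`FinComplex.IsPure.mem_ind_iff`). Hence the exponent monoid of `R_Γ` is the set of all lattice
points of the cone `0 ≤ x_i ≤ x_{n+1}`, `∑_{k ∈ B} x_k ≤ (d - 1) x_{n+1}`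
(`FinComplex.mem_exponentMonoid_of_le`): from such a point one splits off one face at a time.

For each of the linear forms `φ` among `x_{n+1} - x_i` and `f_B`, the ideal generated by the
`x_F t` with `φ(p_F) > 0` consists of the elements all of whose exponents have `φ > 0`. It is prime,
as the part of `φ`-weight zero is multiplicative on `R_Γ` (`FinComplex.isPrime_positiveIdeal`).
These facet ideals are the `P_i` and the `L_B`.

The remaining point is that every prime `Q` containing `t` contains a facet ideal
(`FinComplex.exists_positiveIdeal_le`). If not, multiply together monomials outside `Q`, one for
each `φ` and of positive `φ`-weight. The product is outside `Q`, yet all the forms are positive on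
its exponent, so that by the description of the exponent monoid its `(d - 1)`-st power is divisible
by `t` in `R_Γ`. As the facet ideals are pairwise incomparable
(`FinComplex.eq_of_positiveIdeal_le`), each is minimal over `(t)` and has height one by Krull's
principal ideal theorem. Conversely, a height one prime containing `t` contains a facet ideal, of
the same height, and so equals it.
-/

open MvPolynomial

namespace FinComplex

/-! ### The exponent monoid and the monomials of the toric ring -/

section ToricRing

variable {n : ℕ}

/-- The exponent vector of the monomial `x_F t`. -/
noncomputable def faceExponent (F : Finset (Fin n)) : Option (Fin n) →₀ ℕ :=
  ∑ i ∈ F, Finsupp.single (some i) 1 + Finsupp.single none 1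

/-- The affine monoid of the exponents of the monomials in `R_Γ`. -/
noncomputable def exponentMonoid (Γ : FinComplex n) : AddSubmonoid (Option (Fin n) →₀ ℕ) :=
  AddSubmonoid.closure (faceExponent '' (Γ : Set (Finset (Fin n))))

lemma faceExponent_none (F : Finset (Fin n)) : faceExponent F none = 1 := by
  simp [faceExponent]

lemma faceExponent_some (F : Finset (Fin n)) (i : Fin n) :
    faceExponent F (some i) = if i ∈ F then 1 else 0 := by
  simp [faceExponent, Finsupp.single_apply]

lemma faceExponent_mem_exponentMonoid {Γ : FinComplex n} {F : Finset (Fin n)} (hF : F ∈ Γ) :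
    faceExponent F ∈ exponentMonoid Γ :=
  AddSubmonoid.subset_closure ⟨F, hF, rfl⟩

variable (K : Type*) [Field K]

lemma faceMonomial_eq_monomial (F : Finset (Fin n)) :
    faceMonomial K F = monomial (faceExponent F) 1 := by
  have h := monomial_mul (R := K) (s := ∑ i ∈ F, Finsupp.single (some i) 1) (a := 1)
    (s' := Finsupp.single none 1) (b := 1)
  rw [monomial_sum_one, mul_one] at h
  exact h

lemma faceMonomial_mem_toricRing {Γ : FinComplex n} {F : Finset (Fin n)} (hF : F ∈ Γ) :
    faceMonomial K F ∈ toricRing K Γ :=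
  Algebra.subset_adjoin ⟨F, hF, rfl⟩

lemma monomial_mem_toricRing {Γ : FinComplex n} {a : Option (Fin n) →₀ ℕ}
    (ha : a ∈ exponentMonoid Γ) : (monomial a 1 : MvPolynomial _ K) ∈ toricRing K Γ := by
  induction ha using AddSubmonoid.closure_induction with
  | mem a ha =>
    obtain ⟨F, hF, rfl⟩ := ha
    exact faceMonomial_eq_monomial K F ▸ faceMonomial_mem_toricRing K hF
  | zero => exact one_mem _
  | add a b _ _ ha hb => simpa [monomial_mul] using mul_mem ha hb

variable {K}

lemma mem_exponentMonoid_of_mem_support {Γ : FinComplex n} {f : MvPolynomial (Option (Fin n)) K}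
    (hf : f ∈ toricRing K Γ) {a : Option (Fin n) →₀ ℕ} (ha : a ∈ f.support) :
    a ∈ exponentMonoid Γ := by
  classical
  induction hf using Algebra.adjoin_induction generalizing a with
  | mem f hf =>
    obtain ⟨F, hF, rfl⟩ := hf
    rw [faceMonomial_eq_monomial] at ha
    obtain rfl := Finset.mem_singleton.mp (support_monomial_subset ha)
    exact faceExponent_mem_exponentMonoid hF
  | algebraMap c =>
    obtain rfl := Finset.mem_singleton.mp (support_monomial_subset ha)
    exact zero_mem _
  | add f g _ _ hf hg =>
    exact (Finset.mem_union.mp (support_add ha)).elim hf hg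
  | mul f g _ _ hf hg =>
    obtain ⟨b, hb, c, hc, rfl⟩ := Finset.mem_add.mp (support_mul f g ha)
    exact add_mem (hf hb) (hg hc)

variable (K)

instance isNoetherianRing_toricRing (Γ : FinComplex n) : IsNoetherianRing (toricRing K Γ) := by
  refine isNoetherianRing_of_fg (Subalgebra.fg_def.mpr ⟨_, ?_, rfl⟩)
  exact (Set.toFinite (faceMonomial K '' (Γ : Set (Finset (Fin n))))).subset
    fun f ⟨F, hF, h⟩ => ⟨F, hF, h.symm⟩

end ToricRing

/-! ### The prime ideal of a supporting hyperplane -/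

section PositiveIdeal

variable {n : ℕ} {K : Type*} [Field K]

/-- The ideal of `R_Γ` generated by the `x_F t`, `F ∈ Γ`, whose exponent has positive weight with
respect to the linear form with coefficients `w`. -/
noncomputable def positiveIdeal (K : Type*) [Field K] (Γ : FinComplex n) (w : Option (Fin n) → ℤ) :
    Ideal (toricRing K Γ) :=
  Ideal.span {r | ∃ F ∈ Γ, 0 < Finsupp.weight w (faceExponent F) ∧
    (r : MvPolynomial (Option (Fin n)) K) = faceMonomial K F}

lemma isMonomialIdeal_positiveIdeal (Γ : FinComplex n) (w : Option (Fin n) → ℤ) :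
    IsMonomialIdeal (positiveIdeal K Γ w) := by
  refine ⟨_, ?_, rfl⟩
  rintro r ⟨F, -, -, h⟩
  exact ⟨faceExponent F, h.trans (faceMonomial_eq_monomial K F)⟩

lemma weight_nonneg_of_mem_exponentMonoid {Γ : FinComplex n} {w : Option (Fin n) → ℤ}
    (hw : ∀ F ∈ Γ, 0 ≤ Finsupp.weight w (faceExponent F)) {a : Option (Fin n) →₀ ℕ}
    (ha : a ∈ exponentMonoid Γ) : 0 ≤ Finsupp.weight w a := by
  induction ha using AddSubmonoid.closure_induction with
  | mem a ha =>
    obtain ⟨F, hF, rfl⟩ := ha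
    exact hw F hF
  | zero => simp
  | add a b _ _ ha hb => rw [map_add]; exact add_nonneg ha hb

lemma monomial_mem_positiveIdeal {Γ : FinComplex n} {w : Option (Fin n) → ℤ}
    {a : Option (Fin n) →₀ ℕ} (ha : a ∈ exponentMonoid Γ) (hpos : 0 < Finsupp.weight w a) :
    (⟨monomial a 1, monomial_mem_toricRing K ha⟩ : toricRing K Γ) ∈ positiveIdeal K Γ w := by
  induction ha using AddSubmonoid.closure_induction with
  | mem a ha =>
    obtain ⟨F, hF, rfl⟩ := ha
    exact Ideal.subset_span ⟨F, hF, hpos, (faceMonomial_eq_monomial K F).symm⟩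
  | zero => simp at hpos
  | add a b ha hb iha ihb =>
    have hmul : (⟨monomial (a + b) 1, monomial_mem_toricRing K (add_mem ha hb)⟩ : toricRing K Γ) =
        ⟨monomial a 1, monomial_mem_toricRing K ha⟩ *
          ⟨monomial b 1, monomial_mem_toricRing K hb⟩ :=
      Subtype.ext (by simp [monomial_mul])
    rw [hmul]
    rw [map_add] at hpos
    by_cases h : 0 < Finsupp.weight w a
    · exact Ideal.mul_mem_right _ _ (iha h)
    · exact Ideal.mul_mem_left _ _ (ihb (by lia))

lemma mem_positiveIdeal_iff {Γ : FinComplex n} {w : Option (Fin n) → ℤ}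
    (hw : ∀ F ∈ Γ, 0 ≤ Finsupp.weight w (faceExponent F)) {r : toricRing K Γ} :
    r ∈ positiveIdeal K Γ w ↔
      ∀ a ∈ (r : MvPolynomial (Option (Fin n)) K).support, 0 < Finsupp.weight w a := by
  classical
  constructor
  · intro hr
    induction hr using Submodule.span_induction with
    | mem r hr =>
      obtain ⟨F, -, hpos, h⟩ := hr
      intro a ha
      rw [h, faceMonomial_eq_monomial] at ha
      obtain rfl := Finset.mem_singleton.mp (support_monomial_subset ha)
      exact hpos
    | zero => simp
    | add r s _ _ hr hs =>
      intro a ha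
      rw [AddMemClass.coe_add] at ha
      exact (Finset.mem_union.mp (support_add ha)).elim (hr a) (hs a)
    | smul c r _ hr =>
      intro a ha
      rw [smul_eq_mul, MulMemClass.coe_mul] at ha
      obtain ⟨b, hb, d, hd, rfl⟩ := Finset.mem_add.mp (support_mul _ _ ha)
      rw [map_add]
      exact add_pos_of_nonneg_of_pos (weight_nonneg_of_mem_exponentMonoid hw
        (mem_exponentMonoid_of_mem_support c.2 hb)) (hr d hd)
  · intro h
    have hr : (r : MvPolynomial (Option (Fin n)) K) ∈
        ((positiveIdeal K Γ w).restrictScalars K).map (toricRing K Γ).val.toLinearMap := by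
      rw [(r : MvPolynomial (Option (Fin n)) K).as_sum]
      refine Submodule.sum_mem _ fun a ha => ?_
      have haΓ := mem_exponentMonoid_of_mem_support r.2 ha
      rw [← mul_one (coeff a _), ← smul_eq_mul, ← smul_monomial]
      exact Submodule.smul_mem _ _
        ⟨_, monomial_mem_positiveIdeal haΓ (h a ha), rfl⟩
    obtain ⟨s, hs, hsr⟩ := hr
    exact Subtype.ext hsr ▸ hs

/-- On polynomials whose exponents have nonnegative weight, taking the part of weight zero is
multiplicative. -/
lemma weightedHomogeneousComponent_zero_mul {σ : Type*} {w : σ → ℤ} {f g : MvPolynomial σ K}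
    (hf : ∀ a ∈ f.support, 0 ≤ Finsupp.weight w a) (hg : ∀ a ∈ g.support, 0 ≤ Finsupp.weight w a) :
    weightedHomogeneousComponent w 0 (f * g) =
      weightedHomogeneousComponent w 0 f * weightedHomogeneousComponent w 0 g := by
  classical
  ext a
  simp only [coeff_weightedHomogeneousComponent, coeff_mul]
  trans ∑ p ∈ Finset.HasAntidiagonal.antidiagonal a,
    if Finsupp.weight w a = 0 then coeff p.1 f * coeff p.2 g else 0
  · split_ifs <;> simp
  refine Finset.sum_congr rfl fun p hp => ?_
  by_cases hf0 : coeff p.1 f = 0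
  · simp [hf0]
  by_cases hg0 : coeff p.2 g = 0
  · simp [hg0]
  have hf1 := hf p.1 (mem_support_iff.mpr hf0)
  have hg1 := hg p.2 (mem_support_iff.mpr hg0)
  rw [← Finset.HasAntidiagonal.mem_antidiagonal.mp hp, map_add]
  split_ifs <;> lia

lemma isPrime_positiveIdeal {Γ : FinComplex n} {w : Option (Fin n) → ℤ}
    (hw : ∀ F ∈ Γ, 0 ≤ Finsupp.weight w (faceExponent F)) : (positiveIdeal K Γ w).IsPrime := by
  classical
  have hiff (r : toricRing K Γ) : r ∈ positiveIdeal K Γ w ↔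
      weightedHomogeneousComponent w 0 (r : MvPolynomial (Option (Fin n)) K) = 0 := by
    rw [mem_positiveIdeal_iff hw]
    constructor
    · exact fun h => weightedHomogeneousComponent_eq_zero' _ _ fun a ha => (h a ha).ne'
    · intro h a ha
      refine (weight_nonneg_of_mem_exponentMonoid hw
        (mem_exponentMonoid_of_mem_support r.2 ha)).lt_of_ne' fun h0 => mem_support_iff.mp ha ?_
      have := congrArg (coeff a) h
      rwa [coeff_weightedHomogeneousComponent, if_pos h0] at this
  have hnonneg (r : toricRing K Γ) (a) (ha : a ∈ (r : MvPolynomial (Option (Fin n)) K).support) :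
      0 ≤ Finsupp.weight w a :=
    weight_nonneg_of_mem_exponentMonoid hw (mem_exponentMonoid_of_mem_support r.2 ha)
  refine Ideal.isPrime_iff.mpr ⟨?_, fun {r s} hrs => ?_⟩
  · rw [Ne, Ideal.eq_top_iff_one, mem_positiveIdeal_iff hw]
    intro h
    simpa using h 0 (by simp)
  · rw [hiff, MulMemClass.coe_mul,
      weightedHomogeneousComponent_zero_mul (hnonneg r) (hnonneg s)] at hrs
    rw [hiff, hiff]
    exact mul_eq_zero.mp hrs

end PositiveIdeal

/-! ### Normality of the exponent monoid -/

section Normality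

variable {n : ℕ}

/-- One can split off a face: it contains every `i` at which `a` attains the bound `k + 1`, is
contained in the support of `a`, and meets each block `B` in at most `e` elements, but in enough of
them to restore the bound on the block sum. Within `B` one takes `e` elements of the support, or
the whole support if it is smaller. -/
lemma exists_face_le {π : Set (Finset (Fin n))} (hπ : π.PairwiseDisjoint id) {e k : ℕ}
    {a : Fin n → ℕ} (ha : ∀ i, a i ≤ k + 1) (hsum : ∀ B ∈ π, ∑ i ∈ B, a i ≤ e * (k + 1)) :
    ∃ F : Finset (Fin n), (∀ B ∈ π, (F ∩ B).card ≤ e) ∧ (∀ i ∈ F, 0 < a i) ∧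
      (∀ i, a i = k + 1 → i ∈ F) ∧ ∀ B ∈ π, ∑ i ∈ B, a i ≤ e * k + (F ∩ B).card := by
  classical
  have hblock (B : Finset (Fin n)) (hB : B ∈ π) : ∃ G : Finset (Fin n),
      B.filter (fun i => a i = k + 1) ⊆ G ∧ G ⊆ B.filter (fun i => 0 < a i) ∧
        G.card = min e (B.filter (fun i => 0 < a i)).card := by
    have hsub : B.filter (fun i => a i = k + 1) ⊆ B.filter (fun i => 0 < a i) :=
      Finset.monotone_filter_right _ fun i _ hi => by lia
    refine Finset.exists_subsuperset_card_eq hsub (le_min ?_ (Finset.card_le_card hsub))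
      (min_le_right _ _)
    have : (B.filter (fun i => a i = k + 1)).card * (k + 1) ≤ e * (k + 1) := by
      refine le_trans ?_ (hsum B hB)
      rw [← smul_eq_mul]
      refine le_trans (Finset.card_nsmul_le_sum _ a _ fun i hi => ?_)
        (Finset.sum_le_sum_of_subset (Finset.filter_subset _ _))
      exact (Finset.mem_filter.mp hi).2.ge
    exact Nat.le_of_mul_le_mul_right this k.succ_pos
  choose! G hG₁ hG₂ hG₃ using hblock
  let F : Finset (Fin n) := Finset.univ.filter fun i => 0 < a i ∧ ∀ B ∈ π, i ∈ B → i ∈ G B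
  have hF (i) : i ∈ F ↔ 0 < a i ∧ ∀ B ∈ π, i ∈ B → i ∈ G B := by simp [F]
  have hFB (B) (hB : B ∈ π) : F ∩ B = G B := by
    ext i
    rw [Finset.mem_inter, hF]
    refine ⟨fun h => h.1.2 B hB h.2, fun h => ?_⟩
    obtain ⟨hiB, hpos⟩ := Finset.mem_filter.mp (hG₂ B hB h)
    refine ⟨⟨hpos, fun C hC hiC => ?_⟩, hiB⟩
    rwa [← hπ.elim_finset hB hC i hiB hiC]
  refine ⟨F, fun B hB => ?_, fun i hi => ((hF i).mp hi).1, fun i hi => ?_, fun B hB => ?_⟩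
  · rw [hFB B hB, hG₃ B hB]
    exact min_le_left _ _
  · exact (hF i).mpr ⟨by lia, fun B hB hiB => hG₁ B hB (Finset.mem_filter.mpr ⟨hiB, hi⟩)⟩
  · rw [hFB B hB, hG₃ B hB]
    rcases le_total e (B.filter (fun i => 0 < a i)).card with h | h
    · rw [min_eq_left h]
      exact hsum B hB
    · rw [min_eq_right h]
      have h1 : ∑ i ∈ B, a i ≤ (B.filter (fun i => 0 < a i)).card * (k + 1) := by
        have : ∑ i ∈ B, a i = ∑ i ∈ B.filter (fun i => 0 < a i), a i := by
          refine (Finset.sum_subset (Finset.filter_subset _ _) fun i hiB hi => ?_).symm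
          by_contra h0
          exact hi (Finset.mem_filter.mpr ⟨hiB, Nat.pos_of_ne_zero h0⟩)
        rw [this, ← smul_eq_mul]
        exact Finset.sum_le_card_nsmul _ _ _ fun i _ => ha i
      have h2 := Nat.mul_le_mul_right k h
      lia

/-- If `Γ` consists of the sets that meet each of the disjoint blocks in at most `e` elements, then
every lattice point satisfying the inequalities of the cone lies in the exponent monoid. -/
lemma mem_exponentMonoid_of_le {Γ : FinComplex n} {π : Set (Finset (Fin n))}
    (hπ : π.PairwiseDisjoint id) {e : ℕ} (hΓ : ∀ F, F ∈ Γ ↔ ∀ B ∈ π, (F ∩ B).card ≤ e)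
    {a : Option (Fin n) →₀ ℕ} (ha : ∀ i, a (some i) ≤ a none)
    (hsum : ∀ B ∈ π, ∑ i ∈ B, a (some i) ≤ e * a none) : a ∈ exponentMonoid Γ := by
  classical
  induction hk : a none generalizing a with
  | zero =>
    have : a = 0 := by
      ext o
      cases o with
      | none => exact hk
      | some i => exact Nat.le_zero.mp (hk ▸ ha i)
    exact this ▸ zero_mem _
  | succ k ih =>
    rw [hk] at hsum
    simp only [hk] at ha
    obtain ⟨F, hF₁, hF₂, hF₃, hF₄⟩ := exists_face_le hπ ha hsum
    have hle : faceExponent F ≤ a := by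
      intro o
      cases o with
      | none => simp [faceExponent_none, hk]
      | some i =>
        rw [faceExponent_some]
        split_ifs with hi
        · exact hF₂ i hi
        · exact Nat.zero_le _
    rw [← tsub_add_cancel_of_le hle]
    refine add_mem ?_ (faceExponent_mem_exponentMonoid ((hΓ F).mpr hF₁))
    have hnone : (a - faceExponent F) none = k := by simp [faceExponent_none, hk]
    refine ih (fun i => ?_) (fun B hB => ?_) hnone
    · rw [hnone, Finsupp.tsub_apply, faceExponent_some]
      have := ha i
      split_ifs with hi
      · lia
      · have := mt (hF₃ i) hi
        lia
    · have h : ∑ i ∈ B, a (some i) =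
          ∑ i ∈ B, (a - faceExponent F) (some i) + (F ∩ B).card := by
        rw [Finset.inter_comm, ← Finset.filter_mem_eq_inter, Finset.card_filter,
          ← Finset.sum_add_distrib]
        refine Finset.sum_congr rfl fun i _ => ?_
        rw [← faceExponent_some, Finsupp.tsub_apply, Nat.sub_add_cancel (hle _)]
      have := hF₄ B hB
      rw [hnone]
      lia

end Normality

/-! ### Independence complexes and maximal cliques -/

section Cliques

variable {n : ℕ} {Δ : FinComplex n}

lemma card_le_rank {F : Finset (Fin n)} (hF : F ∈ Δ) : F.card ≤ rank Δ :=
  le_csSup ⟨n, by rintro _ ⟨G, -, rfl⟩; simpa using G.card_le_univ⟩ ⟨F, hF, rfl⟩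

lemma exists_mem_card_eq_rank (h : 0 < rank Δ) : ∃ F ∈ Δ, F.card = rank Δ := by
  have hne : (Finset.card '' (Δ : Set (Finset (Fin n)))).Nonempty := by
    by_contra hne
    rw [Set.not_nonempty_iff_eq_empty] at hne
    simp [rank, hne] at h
  exact Nat.sSup_mem hne ⟨n, by rintro _ ⟨G, -, rfl⟩; simpa using G.card_le_univ⟩

lemma IsPure.card_eq_rank (hΔ : IsPure Δ) (h : 0 < rank Δ) {F : Finset (Fin n)}
    (hF : IsFacet Δ F) : F.card = rank Δ := by
  obtain ⟨G, hG, hcard⟩ := exists_mem_card_eq_rank h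
  refine (hΔ F G hF ⟨hG, fun H hH hGH => ?_⟩).trans hcard
  exact (Finset.eq_of_subset_of_card_le hGH ((card_le_rank hH).trans hcard.ge)).ge

/-- In a pure complex the sets without facets are those that meet each maximal clique in fewer
than `d` elements, since every facet is a clique and so lies in a maximal one. -/
lemma IsPure.mem_ind_iff (hΔ : IsPure Δ) (h : 0 < rank Δ) (F : Finset (Fin n)) :
    F ∈ ind Δ ↔ ∀ B ∈ maximalCliques Δ, (F ∩ B).card ≤ rank Δ - 1 := by
  classical
  constructor
  · intro hF B hB
    by_contra! hlt
    obtain ⟨S, hS, hcard⟩ := Finset.exists_subset_card_eq (Nat.le_of_pred_lt hlt)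
    exact hF S (hB.1.1 S (hS.trans Finset.inter_subset_right) hcard)
      (hS.trans Finset.inter_subset_left)
  · intro hF G hG hGF
    have hcard := hΔ.card_eq_rank h hG
    have hclique : IsClique Δ G := fun S hS hSc => by
      rwa [Finset.eq_of_subset_of_card_le hS (by lia)]
    obtain ⟨B, hGB, hB⟩ := Set.Finite.exists_le_maximal (Set.toFinite {C | IsClique Δ C}) hclique
    have := hF B ⟨hB, hcard ▸ Finset.card_le_card hGB⟩
    have := Finset.card_le_card (Finset.subset_inter hGF hGB)
    lia

end Cliques

/-! ### Primes containing `t` -/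

section PrimesContainingT

variable {n : ℕ} {K : Type*} [Field K]

/-- For a prime `Q` of `R_Γ`, the exponents of the monomials outside `Q`. -/
def exponentsOutside {Γ : FinComplex n} (Q : Ideal (toricRing K Γ)) [hQ : Q.IsPrime] :
    AddSubmonoid (Option (Fin n) →₀ ℕ) where
  carrier := {a | ∃ r ∉ Q, (r : MvPolynomial (Option (Fin n)) K) = monomial a 1}
  zero_mem' := ⟨1, (Ideal.ne_top_iff_one _).mp hQ.ne_top, rfl⟩
  add_mem' := by
    rintro a b ⟨r, hr, hra⟩ ⟨s, hs, hsb⟩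
    exact ⟨r * s, hQ.mul_notMem hr hs, by simp [hra, hsb, monomial_mul]⟩

/-- A monomial that is a multiple in `R_Γ` of a monomial `t ∈ Q` is not outside `Q`. -/
lemma notMem_exponentsOutside {Γ : FinComplex n} {Q : Ideal (toricRing K Γ)} [Q.IsPrime]
    {t : toricRing K Γ} (htQ : t ∈ Q) {c : Option (Fin n) →₀ ℕ}
    (ht : (t : MvPolynomial (Option (Fin n)) K) = monomial c 1) {a : Option (Fin n) →₀ ℕ}
    (ha : a ∈ exponentMonoid Γ) : a + c ∉ exponentsOutside Q := by
  rintro ⟨r, hr, h⟩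
  refine hr ?_
  have : r = ⟨monomial a 1, monomial_mem_toricRing K ha⟩ * t :=
    Subtype.ext (by simp [h, ht, monomial_mul])
  rw [this]
  exact Ideal.mul_mem_left _ _ htQ

/-- If a prime does not contain `positiveIdeal K Γ w`, some monomial outside it has positive
weight. -/
lemma exists_exponentsOutside_of_not_le {Γ : FinComplex n} {Q : Ideal (toricRing K Γ)} [Q.IsPrime]
    {w : Option (Fin n) → ℤ} (h : ¬ positiveIdeal K Γ w ≤ Q) :
    ∃ a ∈ exponentsOutside Q, 0 < Finsupp.weight w a := by
  by_contra! hall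
  refine h (Ideal.span_le.mpr ?_)
  rintro r ⟨F, -, hpos, hr⟩
  by_contra hrQ
  exact (hall _ ⟨r, hrQ, hr.trans (faceMonomial_eq_monomial K F)⟩).not_gt hpos

lemma exponentsOutside_le {Γ : FinComplex n} (Q : Ideal (toricRing K Γ)) [Q.IsPrime] :
    exponentsOutside Q ≤ exponentMonoid Γ := by
  rintro a ⟨r, -, h⟩
  exact mem_exponentMonoid_of_mem_support r.2 (by simp [h])

end PrimesContainingT

/-! ### The facets of the cone -/

section FacetWeights

variable {n : ℕ}

/-- The coefficients of the linear forms `x_{n+1} - x_i` and `f_B` that cut out the cone, together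
with the `x_i ≥ 0`. -/
noncomputable def facetWeight (Δ : FinComplex n) :
    Fin n ⊕ maximalCliques Δ → Option (Fin n) → ℤ
  | .inl i, o => o.elim 1 fun j => if j = i then -1 else 0
  | .inr B, o => o.elim (dim Δ) fun j => if j ∈ B.1 then -1 else 0

lemma weight_facetWeight_inl (Δ : FinComplex n) (i : Fin n) (a : Option (Fin n) →₀ ℕ) :
    Finsupp.weight (facetWeight Δ (.inl i)) a = a none - a (some i) := by
  rw [Finsupp.weight_apply, Finsupp.sum_fintype _ _ (by simp)]
  simp [Fintype.sum_option, facetWeight]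
  ring

lemma weight_facetWeight_inr (Δ : FinComplex n) (B : maximalCliques Δ)
    (a : Option (Fin n) →₀ ℕ) :
    Finsupp.weight (facetWeight Δ (.inr B)) a =
      dim Δ * a none - ∑ i ∈ B.1, (a (some i) : ℤ) := by
  rw [Finsupp.weight_apply, Finsupp.sum_fintype _ _ (by simp)]
  simp [Fintype.sum_option, facetWeight, Finset.sum_ite_mem]
  ring

lemma weight_facetWeight_inl_faceExponent (Δ : FinComplex n) (i : Fin n) (F : Finset (Fin n)) :
    Finsupp.weight (facetWeight Δ (.inl i)) (faceExponent F) = if i ∈ F then 0 else 1 := by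
  rw [weight_facetWeight_inl, faceExponent_none, faceExponent_some]
  split_ifs <;> simp

lemma weight_facetWeight_inr_faceExponent (Δ : FinComplex n) (B : maximalCliques Δ)
    (F : Finset (Fin n)) :
    Finsupp.weight (facetWeight Δ (.inr B)) (faceExponent F) = dim Δ - (F ∩ B.1).card := by
  rw [weight_facetWeight_inr, faceExponent_none]
  simp [faceExponent_some, Finset.inter_comm]

lemma cliqueForm_facePoint (Δ : FinComplex n) (B F : Finset (Fin n)) :
    cliqueForm Δ B (facePoint F) = dim Δ - (F ∩ B).card := by
  have h (k : Fin n) : facePoint F (some k) = if k ∈ F then 1 else 0 := by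
    simp [facePoint, Finset.sum_apply, Pi.single_apply]
  have h' : facePoint F none = 1 := by
    simp [facePoint, Finset.sum_apply]
  simp only [cliqueForm, h, h', Finset.inter_comm F B]
  simp
  ring

variable (K : Type*) [Field K]

lemma vertexIdeal_eq_positiveIdeal (Δ : FinComplex n) (i : Fin n) :
    vertexIdeal K (ind Δ) i = positiveIdeal K (ind Δ) (facetWeight Δ (.inl i)) := by
  have h (F : Finset (Fin n)) : F ⊆ Finset.univ.erase i ↔
      0 < Finsupp.weight (facetWeight Δ (.inl i)) (faceExponent F) := by
    rw [weight_facetWeight_inl_faceExponent, Finset.subset_erase]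
    split_ifs <;> simp [*]
  simp only [vertexIdeal, coverIdeal, positiveIdeal, h]

lemma cliqueIdeal_eq_positiveIdeal (Δ : FinComplex n) (B : maximalCliques Δ) :
    cliqueIdeal K Δ B = positiveIdeal K (ind Δ) (facetWeight Δ (.inr B)) := by
  simp only [cliqueIdeal, positiveIdeal, cliqueForm_facePoint,
    weight_facetWeight_inr_faceExponent]

variable {K} {Δ : FinComplex n}

lemma weight_facetWeight_nonneg (hΔ : IsPure Δ) (hdim : 1 < dim Δ) (φ : Fin n ⊕ maximalCliques Δ)
    {F : Finset (Fin n)} (hF : F ∈ ind Δ) :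
    0 ≤ Finsupp.weight (facetWeight Δ φ) (faceExponent F) := by
  cases φ with
  | inl i =>
    rw [weight_facetWeight_inl_faceExponent]
    split_ifs <;> simp
  | inr B =>
    rw [dim] at hdim
    have := (hΔ.mem_ind_iff (by lia) F).mp hF B.1 B.2
    rw [weight_facetWeight_inr_faceExponent, dim]
    lia

/-- The hyperplanes define distinct facets: for `φ ≠ ψ` some face of `Γ` lies on the hyperplane
of `φ` but not on that of `ψ`. For `x_{n+1} - x_i` the face `{i}` serves, and for `f_B` a
suitable `(d - 1)`-subset of `B`. -/
lemma exists_face_weight_eq_zero_of_ne (hΔ : IsPure Δ) (hdim : 1 < dim Δ)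
    (hdisj : (maximalCliques Δ).PairwiseDisjoint id) {φ ψ : Fin n ⊕ maximalCliques Δ}
    (hne : φ ≠ ψ) : ∃ F ∈ ind Δ, Finsupp.weight (facetWeight Δ φ) (faceExponent F) = 0 ∧
      0 < Finsupp.weight (facetWeight Δ ψ) (faceExponent F) := by
  classical
  rw [dim] at hdim
  have hmem := hΔ.mem_ind_iff (by lia)
  cases φ with
  | inl i =>
    have hcard (C : Finset (Fin n)) : ({i} ∩ C).card ≤ 1 :=
      (Finset.card_le_card Finset.inter_subset_left).trans (Finset.card_singleton i).le
    refine ⟨{i}, (hmem _).mpr fun C _ => (hcard C).trans (by lia), ?_, ?_⟩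
    · simp [weight_facetWeight_inl_faceExponent]
    · cases ψ with
      | inl j =>
        rw [weight_facetWeight_inl_faceExponent, if_neg]
        · exact one_pos
        · rw [Finset.mem_singleton]
          exact fun h => hne (by rw [h])
      | inr B =>
        rw [weight_facetWeight_inr_faceExponent, dim]
        have := hcard B.1
        lia
  | inr B =>
    have hBcard := B.2.2
    have hsub (A : Finset (Fin n)) (hA : A ⊆ B.1) (hAcard : rank Δ - 1 ≤ A.card) :
        ∃ F ⊆ A, F ∈ ind Δ ∧
          Finsupp.weight (facetWeight Δ (.inr B)) (faceExponent F) = 0 := by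
      obtain ⟨F, hFA, hF⟩ := Finset.exists_subset_card_eq hAcard
      refine ⟨F, hFA, (hmem F).mpr fun C _ =>
        (Finset.card_le_card Finset.inter_subset_left).trans hF.le, ?_⟩
      rw [weight_facetWeight_inr_faceExponent, dim, Finset.inter_eq_left.mpr (hFA.trans hA), hF]
      lia
    cases ψ with
    | inl j =>
      obtain ⟨F, hFA, hF, h0⟩ := hsub (B.1.erase j) (Finset.erase_subset _ _)
        (by have := Finset.pred_card_le_card_erase (s := B.1) (a := j); lia)
      refine ⟨F, hF, h0, ?_⟩
      rw [weight_facetWeight_inl_faceExponent, if_neg fun h => Finset.notMem_erase j _ (hFA h)]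
      exact one_pos
    | inr C =>
      obtain ⟨F, hFB, hF, h0⟩ := hsub B.1 subset_rfl (by lia)
      refine ⟨F, hF, h0, ?_⟩
      have hBC : Disjoint B.1 C.1 := hdisj B.2 C.2 fun h => hne (by rw [Subtype.ext h])
      rw [weight_facetWeight_inr_faceExponent, dim,
        Finset.disjoint_iff_inter_eq_empty.mp (hBC.mono_left hFB)]
      simp only [Finset.card_empty]
      lia

lemma eq_of_positiveIdeal_le (hΔ : IsPure Δ) (hdim : 1 < dim Δ)
    (hdisj : (maximalCliques Δ).PairwiseDisjoint id) {φ ψ : Fin n ⊕ maximalCliques Δ}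
    (hle : positiveIdeal K (ind Δ) (facetWeight Δ ψ) ≤
      positiveIdeal K (ind Δ) (facetWeight Δ φ)) : φ = ψ := by
  by_contra hne
  obtain ⟨F, hF, h0, hpos⟩ := exists_face_weight_eq_zero_of_ne hΔ hdim hdisj hne
  have hmem : (⟨faceMonomial K F, faceMonomial_mem_toricRing K hF⟩ : toricRing K (ind Δ)) ∈
      positiveIdeal K (ind Δ) (facetWeight Δ φ) :=
    hle (Ideal.subset_span ⟨F, hF, hpos, rfl⟩)
  rw [mem_positiveIdeal_iff fun F hF => weight_facetWeight_nonneg hΔ hdim φ hF] at hmem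
  exact (hmem (faceExponent F) (by simp [faceMonomial_eq_monomial])).ne' h0

/-- A prime containing `t` contains one of the facet ideals. Otherwise a product of monomials
outside the prime has an exponent on which all the facet weights are positive; by normality a
power of it is divisible by `t` in the ring. -/
lemma exists_positiveIdeal_le (hΔ : IsPure Δ) (hdim : 1 < dim Δ)
    (hdisj : (maximalCliques Δ).PairwiseDisjoint id) {Q : Ideal (toricRing K (ind Δ))}
    [Q.IsPrime] {t : toricRing K (ind Δ)} (htQ : t ∈ Q)
    (ht : (t : MvPolynomial (Option (Fin n)) K) = X none) :
    ∃ φ, positiveIdeal K (ind Δ) (facetWeight Δ φ) ≤ Q := by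
  classical
  by_contra! hall
  have : Fintype (maximalCliques Δ) := Fintype.ofFinite _
  choose b hb hbpos using fun φ => exists_exponentsOutside_of_not_le (hall φ)
  have hbmem : ∑ φ, b φ ∈ exponentsOutside Q := sum_mem fun φ _ => hb φ
  have hpos (φ) : 0 < Finsupp.weight (facetWeight Δ φ) (∑ ψ, b ψ) := by
    rw [map_sum]
    exact Finset.sum_pos' (fun ψ _ => weight_nonneg_of_mem_exponentMonoid
      (fun F hF => weight_facetWeight_nonneg hΔ hdim φ hF) (exponentsOutside_le Q (hb ψ)))
      ⟨φ, Finset.mem_univ _, hbpos φ⟩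
  generalize ∑ φ, b φ = c at hbmem hpos
  obtain ⟨e, he⟩ : ∃ e : ℕ, rank Δ = e + 1 := ⟨rank Δ - 1, by rw [dim] at hdim; lia⟩
  have hdim_eq : dim Δ = e := by rw [dim, he]; simp
  have hepos : 1 < e := by rw [hdim_eq] at hdim; exact_mod_cast hdim
  have hvert (i : Fin n) : c (some i) + 1 ≤ c none := by
    have := hpos (.inl i)
    rw [weight_facetWeight_inl] at this
    lia
  have hclique (B) (hB : B ∈ maximalCliques Δ) : ∑ i ∈ B, c (some i) + 1 ≤ e * c none := by
    have := hpos (.inr ⟨B, hB⟩)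
    rw [weight_facetWeight_inr, hdim_eq] at this
    zify
    lia
  -- As `dim Δ > 1` there is a vertex, so the inequality at it makes the degree in `t` positive.
  have hnone : 1 ≤ c none := by
    obtain ⟨F, -, hF⟩ := exists_mem_card_eq_rank (Δ := Δ) (by lia)
    obtain ⟨i, -⟩ := Finset.card_pos.mp (hF ▸ (by lia : 0 < rank Δ))
    have := hvert i
    lia
  -- The weight `f_B` of `t` is `d - 1`, so the `(d - 1)`-st power is needed.
  have hsplit : e • c - Finsupp.single none 1 + Finsupp.single none 1 = e • c := by
    refine tsub_add_cancel_of_le (Finsupp.single_le_iff.mpr ?_)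
    exact Nat.mul_pos (by lia : 0 < e) hnone
  refine notMem_exponentsOutside htQ ht (a := e • c - Finsupp.single none 1) ?_
    (hsplit ▸ nsmul_mem hbmem e)
  refine mem_exponentMonoid_of_le hdisj (e := e)
    (fun F => by rw [hΔ.mem_ind_iff (by lia), he, Nat.add_sub_cancel]) (fun i => ?_)
    fun B hB => ?_
  · have := Nat.mul_le_mul_left e (hvert i)
    simp
    lia
  · have := Nat.mul_le_mul_left e (hclique B hB)
    simp [← Finset.mul_sum, Nat.mul_sub]
    lia

/-- The facet ideals have height one: they are minimal over `t`, since any prime between `(t)` and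
one of them contains a facet ideal and distinct facet ideals are incomparable. -/
lemma positiveIdeal_mem_heightOneMonomialPrimes (hΔ : IsPure Δ) (hdim : 1 < dim Δ)
    (hdisj : (maximalCliques Δ).PairwiseDisjoint id) (φ : Fin n ⊕ maximalCliques Δ) :
    positiveIdeal K (ind Δ) (facetWeight Δ φ) ∈ heightOneMonomialPrimes K (ind Δ) := by
  have hprime := isPrime_positiveIdeal (K := K)
    fun F hF => weight_facetWeight_nonneg hΔ hdim φ hF
  have hempty : (∅ : Finset (Fin n)) ∈ ind Δ :=
    (hΔ.mem_ind_iff (by rw [dim] at hdim; lia) _).mpr (by simp)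
  let t : toricRing K (ind Δ) := ⟨faceMonomial K ∅, faceMonomial_mem_toricRing K hempty⟩
  have ht : (t : MvPolynomial (Option (Fin n)) K) = X none := by simp [t, faceMonomial]
  have htmem : t ∈ positiveIdeal K (ind Δ) (facetWeight Δ φ) := by
    refine Ideal.subset_span ⟨∅, hempty, ?_, rfl⟩
    cases φ with
    | inl i => simp [weight_facetWeight_inl_faceExponent]
    | inr B =>
      rw [weight_facetWeight_inr_faceExponent]
      simp only [Finset.empty_inter, Finset.card_empty]
      lia
  refine ⟨hprime, isMonomialIdeal_positiveIdeal _ _, le_antisymm ?_ ?_, t, htmem, ht⟩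
  · refine Ideal.height_le_one_of_isPrincipal_of_mem_minimalPrimes (Ideal.span {t}) _
      ⟨⟨hprime, (Ideal.span_singleton_le_iff_mem _).mpr htmem⟩, ?_⟩
    rintro Q ⟨hQ, htQ⟩ hQle
    obtain ⟨ψ, hψ⟩ := exists_positiveIdeal_le hΔ hdim hdisj
      ((Ideal.span_singleton_le_iff_mem _).mp htQ) ht
    obtain rfl := eq_of_positiveIdeal_le hΔ hdim hdisj (hψ.trans hQle)
    exact hψ
  · rw [Order.one_le_iff_ne_zero, Ne, Ideal.height_eq_zero_iff_eq_bot]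
    intro hbot
    rw [hbot, Ideal.mem_bot] at htmem
    rw [htmem] at ht
    exact X_ne_zero none ht.symm

lemma exists_eq_positiveIdeal (hΔ : IsPure Δ) (hdim : 1 < dim Δ)
    (hdisj : (maximalCliques Δ).PairwiseDisjoint id) {Q : Ideal (toricRing K (ind Δ))}
    (hQ : Q ∈ heightOneMonomialPrimes K (ind Δ)) :
    ∃ φ, Q = positiveIdeal K (ind Δ) (facetWeight Δ φ) := by
  obtain ⟨hprime, -, hheight, t, htQ, ht⟩ := hQ
  obtain ⟨φ, hφ⟩ := exists_positiveIdeal_le hΔ hdim hdisj htQ ht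
  refine ⟨φ, ?_⟩
  obtain ⟨hP, -, hPheight, -⟩ :=
    positiveIdeal_mem_heightOneMonomialPrimes (K := K) hΔ hdim hdisj φ
  have : Q.FiniteHeight := Ideal.finiteHeight_of_isNoetherianRing _
  by_contra hne
  have := Ideal.height_strict_mono_of_isPrime (lt_of_le_of_ne' hφ hne)
  rw [hPheight, hheight] at this
  exact lt_irrefl _ this

end FacetWeights

end FinComplex

/-- If the maximal cliques of a unit-interval complex `Δ` with `dim Δ > 1` partition `V(Δ)`, then
the height one monomial primes of `R_Γ`, `Γ = Ind(Δ)`, containing `t` are exactly the `P_i`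
(`i ∈ [n]`) and the `L_B` (`B` a maximal clique of `Δ`). -/
theorem proposition3p4 (K : Type*) [Field K] (n : ℕ) (Δ : FinComplex n)
    (hΔ : FinComplex.IsUnitInterval Δ) (hdim : 1 < FinComplex.dim Δ)
    (hpart : ∃ π : Finpartition (FinComplex.vertices Δ),
      (π.parts : Set (Finset (Fin n))) = FinComplex.maximalCliques Δ) :
    FinComplex.heightOneMonomialPrimes K (FinComplex.ind Δ) =
      {P | ∃ i : Fin n, P = FinComplex.vertexIdeal K (FinComplex.ind Δ) i} ∪
      {L | ∃ B ∈ FinComplex.maximalCliques Δ, L = FinComplex.cliqueIdeal K Δ B} := by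
  obtain ⟨π, hπ⟩ := hpart
  have hdisj : (FinComplex.maximalCliques Δ).PairwiseDisjoint id := hπ ▸ π.disjoint
  ext Q
  constructor
  · intro hQ
    obtain ⟨i | B, rfl⟩ := FinComplex.exists_eq_positiveIdeal hΔ.1 hdim hdisj hQ
    · exact Or.inl ⟨i, (FinComplex.vertexIdeal_eq_positiveIdeal K Δ i).symm⟩
    · exact Or.inr ⟨B, B.2, (FinComplex.cliqueIdeal_eq_positiveIdeal K Δ B).symm⟩
  · rintro (⟨i, rfl⟩ | ⟨B, hB, rfl⟩)
    · rw [FinComplex.vertexIdeal_eq_positiveIdeal]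
      exact FinComplex.positiveIdeal_mem_heightOneMonomialPrimes hΔ.1 hdim hdisj _
    · rw [FinComplex.cliqueIdeal_eq_positiveIdeal K Δ ⟨B, hB⟩]
      exact FinComplex.positiveIdeal_mem_heightOneMonomialPrimes hΔ.1 hdim hdisj _
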